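/- Let $n\ge2$, $m\ge1$ and $k\ge0$ be integers with $k<n/2$, and let $\sigma>0$. A signal $\mathbf x\in\mathbb R^n$ is observed through $m$ adaptive measurements $$y_i=\langle\mathbf a_i,\mathbf x\rangle+z_i,\qquad i=1,\dots,m,$$ where $z_1,\dots,z_m$ are i.i.d. $\mathcal N(0,\sigma^2)$ and each sensing vector $\mathbf a_i\in\mathbb R^n$, with $\|\mathbf a_i\|_2\le1$, is a (possibly random) function of the history $(\mathbf a_1,y_1,\dots,\mathbf a_{i-1},y_{i-1})$; an estimate $\widehat{\mathbf x}$ is a (possibly random) function of $(\mathbf a_1,y_1,\dots,\mathbf a_m,y_m)$. All the additional randomness used by the sensing strategy and the estimate is independent of the noise. Let $\|\mathbf x\|_0$ denote the number of nonzero components of $\mathbf x$. Then there are constants $C_k$, depending only on $k$, such that for all such $n,k,m,\sigma$ $$\inf\ \sup_{\|\mathbf x\|_0\le k}\ \frac1n\,\mathbb E\|\widehat{\mathbf x}-\mathbf x\|_2^2\ \ge\ C_k\,\frac km\,\sigma^2,$$ where the infimum is over all adaptive sensing strategies and all estimates, and such that $\inf_{k\ge1}C_k\ge\frac1{33}$,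 $C_k\ge\frac1{15}$ for all $k\ge10$, and $C_k=\frac17$ for all sufficiently large $k$. -/

import Mathlib

open MeasureTheory ProbabilityTheory
open scoped ENNReal NNReal

universe u

/-- An adaptive procedure taking `m` measurements of a signal in `ℝⁿ`: a sensing strategy together
with an estimator, both possibly randomized.  All the randomness of the procedure is carried by a
seed `U`, which is independent of the measurement noise.  The sensing vector of step `i` is a
function of `U` and of the previous observations `y₀, …, y_{i-1}`, and it has Euclidean norm at
most `1`.  (The earlier sensing vectors are themselves functions of `U` and of the earlier
observations, so the `i`-th vector may depend on the whole history `a₀, y₀, …, a_{i-1}, y_{i-1}`;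
likewise the estimate may depend on all the sensing vectors and all the observations.) -/
structure AdaptiveProcedure (n m : ℕ) where
  /-- the space of values of the seed -/
  Seed : Type u
  /-- its σ-algebra -/
  [measurableSpaceSeed : MeasurableSpace Seed]
  /-- the law of the seed -/
  seedLaw : Measure Seed
  [isProbabilityMeasure_seedLaw : IsProbabilityMeasure seedLaw]
  /-- the sensing vector of step `i`, given the seed and the observations of the steps before `i` -/
  sense : (i : Fin m) → Seed → (Fin i → ℝ) → EuclideanSpace ℝ (Fin n)
  measurable_sense : ∀ i : Fin m,
    Measurable (fun p : Seed × (Fin i → ℝ) => sense i p.1 p.2)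
  /-- the power constraint -/
  norm_sense_le : ∀ (i : Fin m) (s : Seed) (h : Fin i → ℝ), ‖sense i s h‖ ≤ 1
  /-- the estimate of the signal, given the seed and all the observations -/
  estimate : Seed → (Fin m → ℝ) → EuclideanSpace ℝ (Fin n)
  measurable_estimate : Measurable (fun p : Seed × (Fin m → ℝ) => estimate p.1 p.2)

namespace AdaptiveProcedure

attribute [instance] measurableSpaceSeed isProbabilityMeasure_seedLaw

variable {n m : ℕ}

/-- The observations `y_i = ⟨a_i, x⟩ + z_i` that the procedure collects when the signal is `x`,
its seed is `s` and the noise vector is `z`; here `a_i` is the sensing vector that it selects on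
the basis of `s` and `y₀, …, y_{i-1}`. -/
noncomputable def observation (A : AdaptiveProcedure.{u} n m) (x : EuclideanSpace ℝ (Fin n))
    (s : A.Seed) (z : Fin m → ℝ) (i : Fin m) : ℝ :=
  inner ℝ (A.sense i s (fun j => A.observation x s z ⟨j.val, j.isLt.trans i.isLt⟩)) x + z i
termination_by i.val
decreasing_by exact j.isLt

/-- The mean-squared error `(1/n) 𝔼 ‖x̂ - x‖₂²` of the procedure at the signal `x`, when the noise
has i.i.d. `N(0, σ²)` entries and is independent of the seed (a value in `[0, ∞]`). -/
noncomputable def mse (A : AdaptiveProcedure.{u} n m) (σ : ℝ≥0) (x : EuclideanSpace ℝ (Fin n)) :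
    ℝ≥0∞ :=
  (n : ℝ≥0∞)⁻¹ *
    ∫⁻ p : A.Seed × (Fin m → ℝ), ‖A.estimate p.1 (A.observation x p.1 p.2) - x‖ₑ ^ 2
      ∂(A.seedLaw.prod (Measure.pi fun _ : Fin m => gaussianReal 0 (σ ^ 2)))

end AdaptiveProcedure

/-- The signals in `ℝⁿ` with at most `k` nonzero components. -/
def sparseSignals (n k : ℕ) : Set (EuclideanSpace ℝ (Fin n)) :=
  {x | {j : Fin n | x j ≠ 0}.ncard ≤ k}

/-- The minimax mean-squared error over `k`-sparse signals in `ℝⁿ` for `m` adaptive measurements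
with noise level `σ`: the infimum, over all sensing strategies and estimators, of the worst
mean-squared error over the `k`-sparse signals. -/
noncomputable def minimaxMSE (n k m : ℕ) (σ : ℝ≥0) : ℝ≥0∞ :=
  ⨅ A : AdaptiveProcedure.{u} n m, ⨆ x ∈ sparseSignals n k, A.mse σ x

/-!
The minimax risk is bounded below on signals `δ 1_T` with `T` of size at most `k`.  Let two such
signals differ in the single coordinate `j`, say `x` and `x + δ e_j`.  Under `x`, the log-likelihood
ratio of the observations is a sum of terms `(d_i z_i - d_i² / 2) / σ²`, where `d_i = δ (a_i)_j` is a
function of the past; hence its mean, minus the Kullback–Leibler divergence, is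
`-D = -δ² / (2 σ²) 𝔼 ∑ i, (a_i)_j²`.  This remains true for adaptive measurements
(`lintegral_driftPath`, `AdaptiveProcedure.integral_logRatio`).

For weights `w₀, w₁` on the two signals, the Bayes risk of coordinate `j` is at least
`δ² w₀ w₁ ∫ f₀ f₁ / (w₀ f₀ + w₁ f₁)`, which by the Cauchy–Schwarz inequality is at least
`δ² (w₀ w₁ / (w₀ + w₁)) (∫ √(f₀ f₁))²`, and Jensen's inequality bounds the squared affinity below by
`exp (-D)`.  Both inequalities are used in a linearised form, `exp (-D)` being replaced by its
tangent `exp (-1) (2 - D)` at `1` (`two_point_lower_bound`, `AdaptiveProcedure.two_point_coordRisk`).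
Since the sensing vectors have norm at most `1`, the divergences `D` of all the coordinates sum to
at most `δ² m / (2 σ²)`, which the choice of `δ` makes equal to `n - k + 1`, at most the number of
coordinates outside `T` when `|T| < k`; so the average of `2 - D` over those coordinates is at
least `1`.

It remains to average over `T`.  With weights that make all sets of a given size equally likely, the
two-point bounds between the sizes `s` and `s + 1` give a bound proportional to
`(n - s) (s + 1) / (n + 1)`, which exceeds `(s + 1) / 2` because `s < k < n / 2`.  Summing over a
window `[k - L, k]` of sizes (`window_lower_bound`) yields the constant
`L (k - L + 1) / (2 e (L + 1) k)` for every `L ≤ k` (`le_minimaxMSE`).  For `L = 1` it is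
`1 / (4 e) > 1 / 15`, and for `L = 7` and `k ≥ 100` it exceeds `1 / 7`.
-/

/-! ### Change of drift for Gaussian observations -/

/-- One-dimensional Cameron–Martin formula: moving the mean of a Gaussian variable from `b` to `c`
costs the density `exp ((d t - d² / 2) / v)` with `d = c - b`. -/
lemma lintegral_gaussianReal_shift {v : ℝ≥0} (hv : v ≠ 0) (b c : ℝ) {f : ℝ → ℝ≥0∞}
    (hf : Measurable f) :
    ∫⁻ t, f (c + t) ∂gaussianReal 0 v =
      ∫⁻ t, f (b + t) * ENNReal.ofReal (Real.exp (((c - b) * t - (c - b) ^ 2 / 2) / v))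
        ∂gaussianReal 0 v := by
  have hv' : (v : ℝ) ≠ 0 := by exact_mod_cast hv
  rw [gaussianReal_of_var_ne_zero _ hv,
    lintegral_withDensity_eq_lintegral_mul _ (measurable_gaussianPDF 0 v) (by fun_prop),
    lintegral_withDensity_eq_lintegral_mul _ (measurable_gaussianPDF 0 v) (by fun_prop),
    ← lintegral_sub_right_eq_self _ (c - b)]
  refine lintegral_congr fun t => ?_
  have h1 : c + (t - (c - b)) = b + t := by ring
  have h2 : gaussianPDF 0 v (t - (c - b)) =
      gaussianPDF 0 v t *
        ENNReal.ofReal (Real.exp (((c - b) * t - (c - b) ^ 2 / 2) / v)) := by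
    rw [gaussianPDF, gaussianPDF, ← ENNReal.ofReal_mul (gaussianPDFReal_nonneg 0 v t),
      gaussianPDFReal, gaussianPDFReal, mul_assoc _ (Real.exp _) (Real.exp _), ← Real.exp_add]
    congr 3
    field_simp
    ring
  simp only [Pi.mul_apply, h1, h2]
  ring

/-- The observations produced by the noise vector `z` when the observation of step `i` is the sum
of the noise `z i` and of a drift `b i` that depends on the observations of the earlier steps. -/
noncomputable def driftPath (b : (i : ℕ) → (Fin i → ℝ) → ℝ) :
    (m : ℕ) → (Fin m → ℝ) → Fin m → ℝ
  | 0, z => z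
  | m + 1, z => Fin.snoc (α := fun _ => ℝ) (driftPath b m (Fin.init z))
      (b m (driftPath b m (Fin.init z)) + z (Fin.last m))

/-- The logarithm of the likelihood ratio of the drift `c` against the drift `b`, for Gaussian
noise of variance `v`, expressed through the noise that produces the observations under `b`. -/
noncomputable def driftLogRatio (b c : (i : ℕ) → (Fin i → ℝ) → ℝ) (v : ℝ≥0) (m : ℕ)
    (z : Fin m → ℝ) : ℝ :=
  ∑ i : Fin m, (fun d : ℝ => (d * z i - d ^ 2 / 2) / v)
    (c i (fun j => driftPath b m z ⟨j, j.isLt.trans i.isLt⟩) -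
      b i (fun j => driftPath b m z ⟨j, j.isLt.trans i.isLt⟩))

lemma driftPath_succ_castSucc (b : (i : ℕ) → (Fin i → ℝ) → ℝ) (m : ℕ) (z : Fin (m + 1) → ℝ)
    (i : Fin m) : driftPath b (m + 1) z i.castSucc = driftPath b m (Fin.init z) i := by
  simp [driftPath]

lemma driftPath_succ_last (b : (i : ℕ) → (Fin i → ℝ) → ℝ) (m : ℕ) (z : Fin (m + 1) → ℝ) :
    driftPath b (m + 1) z (Fin.last m) =
      b m (driftPath b m (Fin.init z)) + z (Fin.last m) := by
  simp [driftPath]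

lemma driftPath_apply (b : (i : ℕ) → (Fin i → ℝ) → ℝ) (m : ℕ) (z : Fin m → ℝ) (i : Fin m) :
    driftPath b m z i =
      b i (fun j => driftPath b m z ⟨j, j.isLt.trans i.isLt⟩) + z i := by
  induction m with
  | zero => exact i.elim0
  | succ m ih =>
    refine Fin.lastCases ?_ (fun i => ?_) i
    · rw [driftPath_succ_last]
      congr 2
      funext j
      exact (driftPath_succ_castSucc b m z j).symm
    · rw [driftPath_succ_castSucc, ih]
      congr 2
      funext j
      exact (driftPath_succ_castSucc b m z ⟨j, j.isLt.trans i.isLt⟩).symm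

lemma measurable_driftPath {b : (i : ℕ) → (Fin i → ℝ) → ℝ} (hb : ∀ i, Measurable (b i)) (m : ℕ) :
    Measurable (driftPath b m) := by
  induction m with
  | zero => exact measurable_id
  | succ m ih =>
    have hinit : Measurable (fun z : Fin (m + 1) → ℝ => (Fin.init z : Fin m → ℝ)) :=
      measurable_pi_lambda _ fun i => measurable_pi_apply _
    refine measurable_pi_lambda _ fun i => ?_
    refine Fin.lastCases ?_ (fun i => ?_) i
    · simp only [driftPath_succ_last]
      exact ((hb m).comp (ih.comp hinit)).add (measurable_pi_apply _)
    · simp only [driftPath_succ_castSucc]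
      exact (measurable_pi_apply i).comp (ih.comp hinit)

lemma driftLogRatio_succ (b c : (i : ℕ) → (Fin i → ℝ) → ℝ) (v : ℝ≥0) (m : ℕ)
    (z : Fin (m + 1) → ℝ) :
    driftLogRatio b c v (m + 1) z = driftLogRatio b c v m (Fin.init z) +
      (fun d : ℝ => (d * z (Fin.last m) - d ^ 2 / 2) / v)
        (c m (driftPath b m (Fin.init z)) - b m (driftPath b m (Fin.init z))) := by
  have key : ∀ i : Fin m, (fun j : Fin i => driftPath b (m + 1) z ⟨j, by omega⟩) =
      fun j : Fin i => driftPath b m (Fin.init z) ⟨j, by omega⟩ := fun i =>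
    funext fun j => driftPath_succ_castSucc b m z ⟨j, j.isLt.trans i.isLt⟩
  have key' : (fun j : Fin m => driftPath b (m + 1) z ⟨j, by omega⟩) =
      driftPath b m (Fin.init z) := funext fun j => driftPath_succ_castSucc b m z j
  unfold driftLogRatio
  rw [Fin.sum_univ_castSucc]
  congr 1
  · refine Finset.sum_congr rfl fun i _ => ?_
    have := key i
    simp only [Fin.val_castSucc, Fin.init] at this ⊢
    rw [this]
  · simp only [Fin.val_last]
    rw [key']

lemma measurable_driftLogRatio {b c : (i : ℕ) → (Fin i → ℝ) → ℝ} (hb : ∀ i, Measurable (b i))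
    (hc : ∀ i, Measurable (c i)) (v : ℝ≥0) (m : ℕ) : Measurable (driftLogRatio b c v m) := by
  unfold driftLogRatio
  refine Finset.measurable_sum _ fun i _ => ?_
  have h : Measurable fun z : Fin m → ℝ =>
      (fun j : Fin i => driftPath b m z ⟨j, j.isLt.trans i.isLt⟩) :=
    measurable_pi_lambda _ fun j => (measurable_pi_apply _).comp (measurable_driftPath hb m)
  have hd := ((hc i).comp h).sub ((hb i).comp h)
  exact ((hd.mul (measurable_pi_apply i)).sub ((hd.pow_const 2).div_const 2)).div_const _

/-- Integration over a product of `m + 1` copies of a measure, last coordinate innermost. -/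
lemma lintegral_pi_succ (μ : Measure ℝ) [SigmaFinite μ] (m : ℕ) {F : (Fin (m + 1) → ℝ) → ℝ≥0∞}
    (hF : Measurable F) :
    ∫⁻ z, F z ∂(Measure.pi fun _ : Fin (m + 1) => μ) =
      ∫⁻ y, ∫⁻ t, F (Fin.snoc (α := fun _ => ℝ) y t) ∂μ ∂(Measure.pi fun _ : Fin m => μ) := by
  have hmp := (measurePreserving_piFinSuccAbove (fun _ : Fin (m + 1) => μ) (Fin.last m)).symm
  have hF' : Measurable fun p => F ((MeasurableEquiv.piFinSuccAbove (fun _ => ℝ)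
      (Fin.last m)).symm p) := hF.comp hmp.measurable
  rw [← hmp.lintegral_comp hF, lintegral_prod_symm _ hF'.aemeasurable]
  refine lintegral_congr fun y => lintegral_congr fun t => ?_
  congr 1
  simp only [MeasurableEquiv.piFinSuccAbove, Fin.insertNthEquiv_last]
  rfl

/-- **Change of drift**: the law of the observations under the drift `c` has density
`exp (driftLogRatio b c v m)` with respect to their law under the drift `b`. -/
theorem lintegral_driftPath {b c : (i : ℕ) → (Fin i → ℝ) → ℝ} (hb : ∀ i, Measurable (b i))
    (hc : ∀ i, Measurable (c i)) {v : ℝ≥0} (hv : v ≠ 0) (m : ℕ) {F : (Fin m → ℝ) → ℝ≥0∞}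
    (hF : Measurable F) :
    ∫⁻ z, F (driftPath c m z) ∂(Measure.pi fun _ : Fin m => gaussianReal 0 v) =
      ∫⁻ z, F (driftPath b m z) * ENNReal.ofReal (Real.exp (driftLogRatio b c v m z))
        ∂(Measure.pi fun _ : Fin m => gaussianReal 0 v) := by
  induction m with
  | zero => simp [driftLogRatio, driftPath]
  | succ m ih =>
    have hsnoc : Measurable fun p : (Fin m → ℝ) × ℝ =>
        (Fin.snoc (α := fun _ => ℝ) p.1 p.2 : Fin (m + 1) → ℝ) := by
      refine measurable_pi_lambda _ fun i => ?_
      refine Fin.lastCases ?_ (fun i => ?_) i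
      · simpa using measurable_snd
      · simpa [Function.comp_def] using (measurable_pi_apply i).comp measurable_fst
    have hFs : ∀ y : Fin m → ℝ, Measurable fun t : ℝ => F (Fin.snoc (α := fun _ => ℝ) y t) :=
      fun y => hF.comp (hsnoc.comp measurable_prodMk_left)
    have hFc : Measurable fun z => F (driftPath c (m + 1) z) := hF.comp (measurable_driftPath hc _)
    have hFb : Measurable fun z => F (driftPath b (m + 1) z) *
        ENNReal.ofReal (Real.exp (driftLogRatio b c v (m + 1) z)) :=
      (hF.comp (measurable_driftPath hb _)).mul
        (measurable_driftLogRatio hb hc v _).exp.ennreal_ofReal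
    rw [lintegral_pi_succ _ _ hFc, lintegral_pi_succ _ _ hFb]
    simp only [driftPath, driftLogRatio_succ, Fin.init_snoc, Fin.snoc_last]
    have hG : Measurable fun y : Fin m → ℝ =>
        ∫⁻ t, F (Fin.snoc (α := fun _ => ℝ) y (c m y + t)) ∂gaussianReal 0 v := by
      refine Measurable.lintegral_prod_right' (f := fun p : (Fin m → ℝ) × ℝ =>
        F (Fin.snoc (α := fun _ => ℝ) p.1 (c m p.1 + p.2))) ?_
      have h := hc m
      exact hF.comp (hsnoc.comp (measurable_fst.prodMk
        ((h.comp measurable_fst).add measurable_snd)))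
    rw [ih hG]
    refine lintegral_congr fun z => ?_
    rw [lintegral_gaussianReal_shift hv (b m (driftPath b m z)) _ (hFs _),
      ← lintegral_mul_const _ (by have := hFs (driftPath b m z); fun_prop)]
    refine lintegral_congr fun t => ?_
    rw [Real.exp_add, ENNReal.ofReal_mul (Real.exp_pos _).le]
    ring

/-! ### The law of an adaptive procedure -/

namespace AdaptiveProcedure

variable {n m : ℕ}

/-- The joint law of the seed and of the noise. -/
noncomputable def law (A : AdaptiveProcedure.{u} n m) (σ : ℝ≥0) : Measure (A.Seed × (Fin m → ℝ)) :=
  A.seedLaw.prod (Measure.pi fun _ : Fin m => gaussianReal 0 (σ ^ 2))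

instance (A : AdaptiveProcedure.{u} n m) (σ : ℝ≥0) : IsProbabilityMeasure (A.law σ) := by
  unfold law; infer_instance

/-- The sensing vector used at step `i` when the signal is `x`, the seed `p.1` and the noise
`p.2`. -/
noncomputable def sensed (A : AdaptiveProcedure.{u} n m) (x : EuclideanSpace ℝ (Fin n))
    (i : Fin m) (p : A.Seed × (Fin m → ℝ)) : EuclideanSpace ℝ (Fin n) :=
  A.sense i p.1 (fun j => A.observation x p.1 p.2 ⟨j.val, j.isLt.trans i.isLt⟩)

/-- The drift of the observations under the signal `x` and the seed `s`, extended by `0` beyond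
step `m`. -/
noncomputable def drift (A : AdaptiveProcedure.{u} n m) (x : EuclideanSpace ℝ (Fin n))
    (s : A.Seed) (i : ℕ) (h : Fin i → ℝ) : ℝ :=
  if hi : i < m then inner ℝ (A.sense ⟨i, hi⟩ s h) x else 0

lemma observation_eq (A : AdaptiveProcedure.{u} n m) (x : EuclideanSpace ℝ (Fin n))
    (p : A.Seed × (Fin m → ℝ)) (i : Fin m) :
    A.observation x p.1 p.2 i = inner ℝ (A.sensed x i p) x + p.2 i := by
  rw [observation, sensed]

lemma measurable_drift (A : AdaptiveProcedure.{u} n m) (x : EuclideanSpace ℝ (Fin n))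
    (s : A.Seed) (i : ℕ) : Measurable (A.drift x s i) := by
  unfold drift
  split_ifs with hi
  · have h := (A.measurable_sense ⟨i, hi⟩).comp (measurable_prodMk_left (x := s))
    exact Measurable.inner h measurable_const
  · exact measurable_const

lemma driftPath_drift (A : AdaptiveProcedure.{u} n m) (x : EuclideanSpace ℝ (Fin n))
    (s : A.Seed) (z : Fin m → ℝ) : driftPath (A.drift x s) m z = A.observation x s z := by
  funext ⟨i, hi⟩
  induction i using Nat.strong_induction_on with
  | _ i ih =>
    rw [driftPath_apply, observation, drift, dif_pos hi]
    congr 4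
    funext j
    exact ih j j.isLt _

lemma measurable_observation (A : AdaptiveProcedure.{u} n m) (x : EuclideanSpace ℝ (Fin n)) :
    Measurable fun p : A.Seed × (Fin m → ℝ) => A.observation x p.1 p.2 := by
  refine measurable_pi_lambda _ fun ⟨i, hi⟩ => ?_
  induction i using Nat.strong_induction_on with
  | _ i ih =>
    simp_rw [A.observation_eq]
    have h : Measurable fun p : A.Seed × (Fin m → ℝ) =>
        (p.1, fun j : Fin i => A.observation x p.1 p.2 ⟨j.val, j.isLt.trans hi⟩) :=
      measurable_fst.prodMk (measurable_pi_lambda _ fun j => ih j j.isLt _)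
    have h' := (A.measurable_sense ⟨i, hi⟩).comp h
    exact (Measurable.inner h' measurable_const).add
      ((measurable_pi_apply _).comp measurable_snd)

lemma measurable_sensed (A : AdaptiveProcedure.{u} n m) (x : EuclideanSpace ℝ (Fin n))
    (i : Fin m) : Measurable (A.sensed x i) := by
  have h : Measurable fun p : A.Seed × (Fin m → ℝ) =>
      (p.1, fun j : Fin i => A.observation x p.1 p.2 ⟨j.val, j.isLt.trans i.isLt⟩) :=
    measurable_fst.prodMk (measurable_pi_lambda _ fun j =>
      (measurable_pi_apply _).comp (A.measurable_observation x))
  exact (A.measurable_sense i).comp h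

lemma norm_sensed_le (A : AdaptiveProcedure.{u} n m) (x : EuclideanSpace ℝ (Fin n))
    (i : Fin m) (p : A.Seed × (Fin m → ℝ)) : ‖A.sensed x i p‖ ≤ 1 := A.norm_sense_le _ _ _

lemma abs_sensed_apply_le (A : AdaptiveProcedure.{u} n m) (x : EuclideanSpace ℝ (Fin n))
    (i : Fin m) (p : A.Seed × (Fin m → ℝ)) (j : Fin n) : |A.sensed x i p j| ≤ 1 :=
  (PiLp.norm_apply_le (A.sensed x i p) j).trans (A.norm_sensed_le x i p)

lemma measurable_sensed_apply (A : AdaptiveProcedure.{u} n m) (x : EuclideanSpace ℝ (Fin n))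
    (i : Fin m) (j : Fin n) : Measurable fun p => A.sensed x i p j := by
  have := A.measurable_sensed x i
  fun_prop

/-- The observations before step `i` do not depend on the noise from step `i` on. -/
lemma observation_congr (A : AdaptiveProcedure.{u} n m) (x : EuclideanSpace ℝ (Fin n))
    (s : A.Seed) (z z' : Fin m → ℝ) (i : Fin m) (hz : ∀ j < i, z j = z' j) (j : Fin m)
    (hj : j < i) : A.observation x s z j = A.observation x s z' j := by
  obtain ⟨j, hjm⟩ := j
  induction j using Nat.strong_induction_on with
  | _ j ih =>
    rw [observation, observation, hz _ hj]
    congr 3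
    funext l
    exact ih l l.isLt _ (lt_trans (Fin.mk_lt_mk.2 l.isLt) hj)

/-- The log-likelihood ratio of the signal `x + δ e_j` against the signal `x`, expressed through
the seed and the noise that produce the observations under `x`. -/
noncomputable def logRatio (A : AdaptiveProcedure.{u} n m) (σ : ℝ≥0)
    (x : EuclideanSpace ℝ (Fin n)) (j : Fin n) (δ : ℝ) (p : A.Seed × (Fin m → ℝ)) : ℝ :=
  ∑ i : Fin m, (δ * A.sensed x i p j * p.2 i - (δ * A.sensed x i p j) ^ 2 / 2) / (σ : ℝ) ^ 2

lemma measurable_logRatio (A : AdaptiveProcedure.{u} n m) (σ : ℝ≥0)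
    (x : EuclideanSpace ℝ (Fin n)) (j : Fin n) (δ : ℝ) : Measurable (A.logRatio σ x j δ) := by
  unfold logRatio
  refine Finset.measurable_sum _ fun i _ => ?_
  have h : Measurable fun p => δ * A.sensed x i p j :=
    (A.measurable_sensed_apply x i j).const_mul δ
  exact ((h.mul ((measurable_pi_apply i).comp measurable_snd)).sub
    ((h.pow_const 2).div_const 2)).div_const _

lemma driftLogRatio_drift (A : AdaptiveProcedure.{u} n m) (σ : ℝ≥0)
    (x : EuclideanSpace ℝ (Fin n)) (j : Fin n) (δ : ℝ) (s : A.Seed) (z : Fin m → ℝ) :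
    driftLogRatio (A.drift x s) (A.drift (x + EuclideanSpace.single j δ) s) (σ ^ 2) m z =
      A.logRatio σ x j δ (s, z) := by
  unfold driftLogRatio logRatio
  refine Finset.sum_congr rfl fun i _ => ?_
  have h : A.drift (x + EuclideanSpace.single j δ) s i
        (fun l => driftPath (A.drift x s) m z ⟨l, l.isLt.trans i.isLt⟩) -
      A.drift x s i (fun l => driftPath (A.drift x s) m z ⟨l, l.isLt.trans i.isLt⟩) =
      δ * A.sensed x i (s, z) j := by
    simp only [drift, dif_pos i.isLt, driftPath_drift, inner_add_right, sensed,
      EuclideanSpace.inner_single_right]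
    simp
  simp only [h]
  push_cast
  rfl

/-- Change of signal: the observations under `x + δ e_j` have density `exp (logRatio σ x j δ)` with
respect to those under `x`. -/
lemma lintegral_observation_add_single (A : AdaptiveProcedure.{u} n m) {σ : ℝ≥0} (hσ : σ ≠ 0)
    (x : EuclideanSpace ℝ (Fin n)) (j : Fin n) (δ : ℝ) {F : A.Seed × (Fin m → ℝ) → ℝ≥0∞}
    (hF : Measurable F) :
    ∫⁻ p, F (p.1, A.observation (x + EuclideanSpace.single j δ) p.1 p.2) ∂A.law σ =
      ∫⁻ p, F (p.1, A.observation x p.1 p.2) * ENNReal.ofReal (Real.exp (A.logRatio σ x j δ p))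
        ∂A.law σ := by
  have hobs : ∀ y, Measurable fun p : A.Seed × (Fin m → ℝ) =>
      F (p.1, A.observation y p.1 p.2) := fun y =>
    hF.comp (measurable_fst.prodMk (A.measurable_observation y))
  unfold law
  have hobs' : Measurable fun p : A.Seed × (Fin m → ℝ) => F (p.1, A.observation x p.1 p.2) *
      ENNReal.ofReal (Real.exp (A.logRatio σ x j δ p)) :=
    (hobs _).mul (A.measurable_logRatio σ x j δ).exp.ennreal_ofReal
  rw [lintegral_prod _ (hobs _).aemeasurable, lintegral_prod _ hobs'.aemeasurable]
  refine lintegral_congr fun s => ?_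
  have h := lintegral_driftPath (A.measurable_drift x s)
    (A.measurable_drift (x + EuclideanSpace.single j δ) s) (pow_ne_zero 2 hσ) m
    (hF.comp (measurable_prodMk_left (x := s)))
  simpa only [driftPath_drift, driftLogRatio_drift, Function.comp_apply] using h

/-- Flipping the sign of the noise of one step preserves the joint law. -/
lemma measurePreserving_flip (A : AdaptiveProcedure.{u} n m) (σ : ℝ≥0) (i : Fin m) :
    MeasurePreserving (fun p : A.Seed × (Fin m → ℝ) =>
      (p.1, fun l => if l = i then -p.2 l else p.2 l)) (A.law σ) (A.law σ) := by
  refine (MeasurePreserving.id A.seedLaw).prod (measurePreserving_pi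
    (f := fun l t => if l = i then -t else t) _ _ fun l => ?_)
  by_cases h : l = i
  · simp only [h, if_true]
    exact ⟨measurable_neg, by simpa using gaussianReal_map_neg (μ := 0) (v := σ ^ 2)⟩
  · simp only [h, if_false]
    exact MeasurePreserving.id _

lemma integrable_noise (A : AdaptiveProcedure.{u} n m) (σ : ℝ≥0) (i : Fin m) :
    Integrable (fun p : A.Seed × (Fin m → ℝ) => p.2 i) (A.law σ) := by
  have h1 : Integrable (fun t : ℝ => t) (gaussianReal 0 (σ ^ 2)) :=
    memLp_one_iff_integrable.1 (memLp_id_gaussianReal 1)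
  have h2 := (measurePreserving_eval (fun _ : Fin m => gaussianReal 0 (σ ^ 2)) i).comp
    (measurePreserving_snd (μ := A.seedLaw)
      (ν := Measure.pi fun _ : Fin m => gaussianReal 0 (σ ^ 2)))
  exact h2.integrable_comp_of_integrable h1

lemma integrable_sensed_mul_noise (A : AdaptiveProcedure.{u} n m) (σ : ℝ≥0)
    (x : EuclideanSpace ℝ (Fin n)) (i : Fin m) (j : Fin n) :
    Integrable (fun p => A.sensed x i p j * p.2 i) (A.law σ) :=
  (A.integrable_noise σ i).bdd_mul (c := 1) (A.measurable_sensed_apply x i j).aestronglyMeasurable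
    (ae_of_all _ fun p => A.abs_sensed_apply_le x i p j)

/-- The sensing vector of a step is uncorrelated with the noise of that step. -/
lemma integral_sensed_mul_noise (A : AdaptiveProcedure.{u} n m) (σ : ℝ≥0)
    (x : EuclideanSpace ℝ (Fin n)) (i : Fin m) (j : Fin n) :
    ∫ p, A.sensed x i p j * p.2 i ∂A.law σ = 0 := by
  have hmp := A.measurePreserving_flip σ i
  have h := integral_map hmp.measurable.aemeasurable (μ := A.law σ)
    (f := fun p => A.sensed x i p j * p.2 i)
    (by rw [hmp.map_eq]; exact (A.integrable_sensed_mul_noise σ x i j).aestronglyMeasurable)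
  rw [hmp.map_eq] at h
  have hs : ∀ p : A.Seed × (Fin m → ℝ),
      A.sensed x i (p.1, fun l => if l = i then -p.2 l else p.2 l) = A.sensed x i p := by
    intro p
    unfold sensed
    congr 1
    funext l
    refine A.observation_congr x p.1 _ _ i (fun l hl => ?_) _ (Fin.mk_lt_of_lt_val l.isLt)
    simp [hl.ne]
  simp only [hs, if_true, mul_neg, integral_neg] at h
  linarith

lemma integrable_sensed_sq (A : AdaptiveProcedure.{u} n m) (σ : ℝ≥0)
    (x : EuclideanSpace ℝ (Fin n)) (i : Fin m) (j : Fin n) :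
    Integrable (fun p => A.sensed x i p j ^ 2) (A.law σ) := by
  refine Integrable.of_bound ((A.measurable_sensed_apply x i j).pow_const 2).aestronglyMeasurable 1
    (ae_of_all _ fun p => ?_)
  rw [Real.norm_eq_abs, abs_pow]
  exact pow_le_one₀ (abs_nonneg _) (A.abs_sensed_apply_le x i p j)

/-- The expected energy `𝔼 ∑ i, (a_i)_j²` that the procedure spends on the coordinate `j` when the
signal is `x`. -/
noncomputable def energy (A : AdaptiveProcedure.{u} n m) (σ : ℝ≥0)
    (x : EuclideanSpace ℝ (Fin n)) (j : Fin n) : ℝ :=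
  ∑ i : Fin m, ∫ p, A.sensed x i p j ^ 2 ∂A.law σ

lemma energy_nonneg (A : AdaptiveProcedure.{u} n m) (σ : ℝ≥0)
    (x : EuclideanSpace ℝ (Fin n)) (j : Fin n) : 0 ≤ A.energy σ x j :=
  Finset.sum_nonneg fun _ _ => integral_nonneg fun _ => sq_nonneg _

lemma sum_energy_le (A : AdaptiveProcedure.{u} n m) (σ : ℝ≥0)
    (x : EuclideanSpace ℝ (Fin n)) (J : Finset (Fin n)) : ∑ j ∈ J, A.energy σ x j ≤ m := by
  calc ∑ j ∈ J, A.energy σ x j ≤ ∑ j, A.energy σ x j :=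
        Finset.sum_le_univ_sum_of_nonneg fun j => A.energy_nonneg σ x j
    _ = ∑ i : Fin m, ∫ p, ∑ j, A.sensed x i p j ^ 2 ∂A.law σ := by
        unfold energy
        rw [Finset.sum_comm]
        exact Finset.sum_congr rfl fun i _ =>
          (integral_finsetSum _ fun j _ => A.integrable_sensed_sq σ x i j).symm
    _ ≤ ∑ _i : Fin m, (1 : ℝ) := by
        refine Finset.sum_le_sum fun i _ => ?_
        calc ∫ p, ∑ j, A.sensed x i p j ^ 2 ∂A.law σ ≤ ∫ _p, (1 : ℝ) ∂A.law σ := by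
              refine integral_mono (integrable_finsetSum _ fun j _ =>
                A.integrable_sensed_sq σ x i j) (integrable_const _) fun p => ?_
              change ∑ j, A.sensed x i p j ^ 2 ≤ 1
              rw [← EuclideanSpace.real_norm_sq_eq]
              exact pow_le_one₀ (norm_nonneg _) (A.norm_sensed_le x i p)
          _ = 1 := by simp
    _ = m := by simp

lemma integrable_logRatio (A : AdaptiveProcedure.{u} n m) (σ : ℝ≥0)
    (x : EuclideanSpace ℝ (Fin n)) (j : Fin n) (δ : ℝ) :
    Integrable (A.logRatio σ x j δ) (A.law σ) := by
  unfold logRatio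
  refine integrable_finsetSum _ fun i _ => Integrable.div_const (Integrable.sub ?_ ?_) _
  · simpa only [mul_assoc] using (A.integrable_sensed_mul_noise σ x i j).const_mul δ
  · simpa only [mul_pow] using ((A.integrable_sensed_sq σ x i j).const_mul (δ ^ 2)).div_const 2

/-- Minus the Kullback–Leibler divergence between the observations under `x` and those under
`x + δ e_j`. -/
lemma integral_logRatio (A : AdaptiveProcedure.{u} n m) (σ : ℝ≥0)
    (x : EuclideanSpace ℝ (Fin n)) (j : Fin n) (δ : ℝ) :
    ∫ p, A.logRatio σ x j δ p ∂A.law σ = -(δ ^ 2 / (2 * (σ : ℝ) ^ 2) * A.energy σ x j) := by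
  have h1 : ∀ i : Fin m, Integrable (fun p => δ * A.sensed x i p j * p.2 i) (A.law σ) := fun i => by
    simpa only [mul_assoc] using (A.integrable_sensed_mul_noise σ x i j).const_mul δ
  have h2 : ∀ i : Fin m, Integrable (fun p => (δ * A.sensed x i p j) ^ 2 / 2) (A.law σ) :=
    fun i => by
      simpa only [mul_pow] using ((A.integrable_sensed_sq σ x i j).const_mul (δ ^ 2)).div_const 2
  have h3 : ∀ i : Fin m, Integrable (fun p => (δ * A.sensed x i p j * p.2 i -
      (δ * A.sensed x i p j) ^ 2 / 2) / (σ : ℝ) ^ 2) (A.law σ) := fun i =>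
    ((h1 i).sub (h2 i)).div_const _
  unfold logRatio energy
  rw [integral_finsetSum _ fun i _ => h3 i, Finset.mul_sum,
    ← Finset.sum_neg_distrib]
  refine Finset.sum_congr rfl fun i _ => ?_
  rw [integral_div, integral_sub (h1 i) (h2 i)]
  simp only [mul_assoc, mul_pow, integral_const_mul, integral_div, A.integral_sensed_mul_noise]
  ring

end AdaptiveProcedure

/-! ### Detecting one coordinate -/

/-- A weighted two-point lower bound, linearised in the log-likelihood ratio `u` and in the
likelihood ratio `exp u`, so that only the means of these two enter its expectation. -/
lemma two_point_lower_bound {w₀ w₁ : ℝ} (h₀ : 0 < w₀) (h₁ : 0 < w₁) (g δ u : ℝ) :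
    δ ^ 2 * (w₀ * w₁ / (w₀ + w₁)) * Real.exp (-1) *
        (3 + u - (w₀ + w₁ * Real.exp u) / (w₀ + w₁)) ≤
      w₀ * g ^ 2 + w₁ * (g - δ) ^ 2 * Real.exp u := by
  -- `q` is the square root of the likelihood ratio and `ρ` that of `exp (-1)`.
  set q := Real.exp (u / 2) with hq
  set ρ := Real.exp (-1 / 2) with hρ
  have hq2 : Real.exp u = q ^ 2 := by
    rw [hq, ← Real.exp_nat_mul]; congr 1; push_cast; ring
  have hρ2 : Real.exp (-1) = ρ ^ 2 := by
    rw [hρ, ← Real.exp_nat_mul]; congr 1; push_cast; ring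
  have hq0 : 0 < q := Real.exp_pos _
  have hρ0 : 0 < ρ := Real.exp_pos _
  have htan : ρ * (3 + u) ≤ 2 * q := by
    have h := Real.add_one_le_exp ((u + 1) / 2)
    have h' : q = ρ * Real.exp ((u + 1) / 2) := by
      rw [hq, hρ, ← Real.exp_add]; congr 1; ring
    rw [h']
    nlinarith
  rw [hq2, hρ2]
  set W := w₀ + w₁ with hW
  set P := w₀ + w₁ * q ^ 2 with hP
  have hW0 : 0 < W := by positivity
  have hP0 : 0 < P := by positivity
  -- The right side is a quadratic in `g`, with minimum `δ² w₀ w₁ q² / P`.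
  have hmin : δ ^ 2 * (w₀ * w₁ * q ^ 2 / P) ≤ w₀ * g ^ 2 + w₁ * (g - δ) ^ 2 * q ^ 2 := by
    rw [← mul_div_assoc, div_le_iff₀ hP0]
    have : (w₀ * g ^ 2 + w₁ * (g - δ) ^ 2 * q ^ 2) * P - δ ^ 2 * (w₀ * w₁ * q ^ 2) =
        (P * g - w₁ * q ^ 2 * δ) ^ 2 := by rw [hP]; ring
    nlinarith [sq_nonneg (P * g - w₁ * q ^ 2 * δ)]
  have hharm : ρ ^ 2 / W * (3 + u - P / W) ≤ q ^ 2 / P := by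
    rw [le_div_iff₀ hP0]
    have h1 : ρ ^ 2 / W * (3 + u - P / W) * P ≤ 2 * (ρ * P / W) * q - (ρ * P / W) ^ 2 := by
      have : ρ ^ 2 / W * (3 + u - P / W) * P =
          (ρ * P / W) * (ρ * (3 + u)) - (ρ * P / W) ^ 2 := by field_simp
      rw [this]
      nlinarith [mul_le_mul_of_nonneg_left htan (by positivity : 0 ≤ ρ * P / W)]
    nlinarith [sq_nonneg (ρ * P / W - q)]
  calc δ ^ 2 * (w₀ * w₁ / W) * ρ ^ 2 * (3 + u - P / W)
      = δ ^ 2 * (w₀ * w₁) * (ρ ^ 2 / W * (3 + u - P / W)) := by ring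
    _ ≤ δ ^ 2 * (w₀ * w₁) * (q ^ 2 / P) := by gcongr
    _ = δ ^ 2 * (w₀ * w₁ * q ^ 2 / P) := by ring
    _ ≤ _ := hmin

lemma ofReal_integral_le_lintegral_ofReal {α : Type*} [MeasurableSpace α] {μ : Measure α}
    {f : α → ℝ} (hf : Integrable f μ) :
    ENNReal.ofReal (∫ a, f a ∂μ) ≤ ∫⁻ a, ENNReal.ofReal (f a) ∂μ := by
  refine ENNReal.ofReal_le_of_le_toReal ?_
  rw [integral_eq_lintegral_pos_part_sub_lintegral_neg_part hf]
  exact sub_le_self _ ENNReal.toReal_nonneg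

namespace AdaptiveProcedure

variable {n m : ℕ}

/-- The expected squared error of the procedure in the coordinate `j` at the signal `x`. -/
noncomputable def coordRisk (A : AdaptiveProcedure.{u} n m) (σ : ℝ≥0)
    (x : EuclideanSpace ℝ (Fin n)) (j : Fin n) : ℝ≥0∞ :=
  ∫⁻ p, ENNReal.ofReal ((A.estimate p.1 (A.observation x p.1 p.2) j - x j) ^ 2) ∂A.law σ

lemma measurable_estimate_apply (A : AdaptiveProcedure.{u} n m) (j : Fin n) :
    Measurable fun p : A.Seed × (Fin m → ℝ) => A.estimate p.1 p.2 j := by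
  exact (EuclideanSpace.proj (𝕜 := ℝ) j).continuous.measurable.comp A.measurable_estimate

lemma measurable_estimate_observation (A : AdaptiveProcedure.{u} n m)
    (x : EuclideanSpace ℝ (Fin n)) (j : Fin n) :
    Measurable fun p : A.Seed × (Fin m → ℝ) =>
      A.estimate p.1 (A.observation x p.1 p.2) j :=
  (A.measurable_estimate_apply j).comp (measurable_fst.prodMk (A.measurable_observation x))

lemma mse_eq_sum_coordRisk (A : AdaptiveProcedure.{u} n m) (σ : ℝ≥0)
    (x : EuclideanSpace ℝ (Fin n)) :
    A.mse σ x = (n : ℝ≥0∞)⁻¹ * ∑ j, A.coordRisk σ x j := by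
  unfold mse coordRisk
  rw [← lintegral_finsetSum _ fun j _ =>
    (((A.measurable_estimate_observation x j).sub_const _).pow_const 2).ennreal_ofReal]
  congr 1
  refine lintegral_congr fun p => ?_
  rw [← ENNReal.ofReal_sum_of_nonneg fun j _ => sq_nonneg _, ← ofReal_norm,
    ← ENNReal.ofReal_pow (norm_nonneg _), EuclideanSpace.real_norm_sq_eq]
  rfl

lemma lintegral_exp_logRatio (A : AdaptiveProcedure.{u} n m) {σ : ℝ≥0} (hσ : σ ≠ 0)
    (x : EuclideanSpace ℝ (Fin n)) (j : Fin n) (δ : ℝ) :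
    ∫⁻ p, ENNReal.ofReal (Real.exp (A.logRatio σ x j δ p)) ∂A.law σ = 1 := by
  have h := A.lintegral_observation_add_single hσ x j δ (F := fun _ => 1) measurable_const
  simpa using h.symm

lemma integrable_exp_logRatio (A : AdaptiveProcedure.{u} n m) {σ : ℝ≥0} (hσ : σ ≠ 0)
    (x : EuclideanSpace ℝ (Fin n)) (j : Fin n) (δ : ℝ) :
    Integrable (fun p => Real.exp (A.logRatio σ x j δ p)) (A.law σ) := by
  refine ⟨(A.measurable_logRatio σ x j δ).exp.aestronglyMeasurable, ?_⟩
  rw [hasFiniteIntegral_iff_ofReal (ae_of_all _ fun p => (Real.exp_pos _).le),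
    A.lintegral_exp_logRatio hσ]
  exact ENNReal.one_lt_top

lemma integral_exp_logRatio (A : AdaptiveProcedure.{u} n m) {σ : ℝ≥0} (hσ : σ ≠ 0)
    (x : EuclideanSpace ℝ (Fin n)) (j : Fin n) (δ : ℝ) :
    ∫ p, Real.exp (A.logRatio σ x j δ p) ∂A.law σ = 1 := by
  rw [integral_eq_lintegral_of_nonneg_ae (ae_of_all _ fun p => (Real.exp_pos _).le)
    (A.measurable_logRatio σ x j δ).exp.aestronglyMeasurable, A.lintegral_exp_logRatio hσ]
  simp

/-- A procedure that spends little energy on the coordinate `j` cannot estimate it accurately at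
both of the signals `x` and `x + δ e_j`. -/
theorem two_point_coordRisk (A : AdaptiveProcedure.{u} n m) {σ : ℝ≥0} (hσ : σ ≠ 0)
    (x : EuclideanSpace ℝ (Fin n)) (j : Fin n) (δ : ℝ) {w₀ w₁ : ℝ} (h₀ : 0 < w₀) (h₁ : 0 < w₁) :
    ENNReal.ofReal (δ ^ 2 * (w₀ * w₁ / (w₀ + w₁)) * Real.exp (-1) *
        (2 - δ ^ 2 / (2 * (σ : ℝ) ^ 2) * A.energy σ x j)) ≤
      ENNReal.ofReal w₀ * A.coordRisk σ x j +
        ENNReal.ofReal w₁ * A.coordRisk σ (x + EuclideanSpace.single j δ) j := by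
  have hest := A.measurable_estimate_apply j
  have hobs := A.measurable_estimate_observation x j
  have hU := A.measurable_logRatio σ x j δ
  have hshift : A.coordRisk σ (x + EuclideanSpace.single j δ) j =
      ∫⁻ p, ENNReal.ofReal ((A.estimate p.1 (A.observation x p.1 p.2) j - x j - δ) ^ 2) *
        ENNReal.ofReal (Real.exp (A.logRatio σ x j δ p)) ∂A.law σ := by
    rw [← A.lintegral_observation_add_single hσ x j δ
      (F := fun p => ENNReal.ofReal ((A.estimate p.1 p.2 j - x j - δ) ^ 2))
      (((hest.sub_const _).sub_const _).pow_const 2).ennreal_ofReal]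
    refine lintegral_congr fun p => ?_
    simp [sub_sub]
  set c := δ ^ 2 * (w₀ * w₁ / (w₀ + w₁)) * Real.exp (-1)
  have hi1 : Integrable (fun p => 3 + A.logRatio σ x j δ p) (A.law σ) :=
    (integrable_const _).add (A.integrable_logRatio σ x j δ)
  have hi2 : Integrable (fun p => w₀ + w₁ * Real.exp (A.logRatio σ x j δ p)) (A.law σ) :=
    (integrable_const _).add ((A.integrable_exp_logRatio hσ x j δ).const_mul _)
  have hi3 : Integrable (fun p => (w₀ + w₁ * Real.exp (A.logRatio σ x j δ p)) / (w₀ + w₁))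
    (A.law σ) := hi2.div_const _
  have hmean : c * (2 - δ ^ 2 / (2 * (σ : ℝ) ^ 2) * A.energy σ x j) =
      ∫ p, c * (3 + A.logRatio σ x j δ p -
        (w₀ + w₁ * Real.exp (A.logRatio σ x j δ p)) / (w₀ + w₁)) ∂A.law σ := by
    rw [integral_const_mul, integral_sub hi1 hi3, integral_div,
      integral_add (integrable_const _) (A.integrable_logRatio σ x j δ),
      integral_add (integrable_const _) ((A.integrable_exp_logRatio hσ x j δ).const_mul _),
      integral_const_mul, A.integral_exp_logRatio hσ, A.integral_logRatio]
    simp only [integral_const, probReal_univ, smul_eq_mul, one_mul, mul_one]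
    rw [div_self (by positivity)]
    ring
  have hm0 : Measurable fun p : A.Seed × (Fin m → ℝ) => ENNReal.ofReal
      ((A.estimate p.1 (A.observation x p.1 p.2) j - x j) ^ 2) :=
    ((hobs.sub_const _).pow_const 2).ennreal_ofReal
  have hm1 : Measurable fun p : A.Seed × (Fin m → ℝ) => ENNReal.ofReal
      ((A.estimate p.1 (A.observation x p.1 p.2) j - x j - δ) ^ 2) *
        ENNReal.ofReal (Real.exp (A.logRatio σ x j δ p)) :=
    (((hobs.sub_const _).sub_const _).pow_const 2).ennreal_ofReal.mul hU.exp.ennreal_ofReal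
  rw [hmean, hshift, coordRisk, ← lintegral_const_mul _ hm0, ← lintegral_const_mul _ hm1,
    ← lintegral_add_left (hm0.const_mul _)]
  refine (ofReal_integral_le_lintegral_ofReal ((hi1.sub hi3).const_mul c)).trans
    (lintegral_mono fun p => ?_)
  rw [← ENNReal.ofReal_mul h₀.le, ← ENNReal.ofReal_mul (sq_nonneg _), ← ENNReal.ofReal_mul h₁.le,
    ← ENNReal.ofReal_add (by positivity) (by positivity)]
  refine ENNReal.ofReal_le_ofReal ?_
  refine (two_point_lower_bound h₀ h₁ (A.estimate p.1 (A.observation x p.1 p.2) j - x j) δ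
    (A.logRatio σ x j δ p)).trans (le_of_eq ?_)
  ring

end AdaptiveProcedure

/-! ### Averaging over supports -/

/-- Removing an element from a set of size `s + 1` is the same as choosing a set of size `s` and an
element outside it. -/
lemma sum_powersetCard_succ {n : ℕ} (s : ℕ) (r : Finset (Fin n) → Fin n → ℝ) :
    ∑ S ∈ Finset.powersetCard (s + 1) Finset.univ, ∑ j ∈ S, r S j =
      ∑ T ∈ Finset.powersetCard s Finset.univ, ∑ j ∈ Tᶜ, r (insert j T) j := by
  rw [Finset.sum_sigma', Finset.sum_sigma']
  refine Finset.sum_bij' (fun p _ => ⟨p.1.erase p.2, p.2⟩) (fun p _ => ⟨insert p.2 p.1, p.2⟩)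
    ?_ ?_ ?_ ?_ ?_
  · rintro ⟨S, j⟩ h
    simp only [Finset.mem_sigma, Finset.mem_powersetCard_univ] at h
    simp [Finset.card_erase_of_mem h.2, h.1]
  · rintro ⟨T, j⟩ h
    simp only [Finset.mem_sigma, Finset.mem_powersetCard_univ, Finset.mem_compl] at h
    simp [Finset.card_insert_of_notMem h.2, h.1]
  · rintro ⟨S, j⟩ h
    simp only [Finset.mem_sigma] at h
    simp [Finset.insert_erase h.2]
  · rintro ⟨T, j⟩ h
    simp only [Finset.mem_sigma, Finset.mem_compl] at h
    simp [Finset.erase_insert h.2]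
  · rintro ⟨S, j⟩ h
    simp only [Finset.mem_sigma] at h
    simp [Finset.insert_erase h.2]

/-- The average over the sets `T` of size `s` of the risk in the coordinates outside `T`. -/
noncomputable def avgOutside {n : ℕ} (r : Finset (Fin n) → Fin n → ℝ) (s : ℕ) : ℝ :=
  (∑ T ∈ Finset.powersetCard s Finset.univ, ∑ j ∈ Tᶜ, r T j) / n.choose s

/-- The average over the sets `T` of size `s` of the risk in the coordinates in `T`. -/
noncomputable def avgInside {n : ℕ} (r : Finset (Fin n) → Fin n → ℝ) (s : ℕ) : ℝ :=
  (∑ T ∈ Finset.powersetCard s Finset.univ, ∑ j ∈ T, r T j) / n.choose s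

lemma avgOutside_add_avgInside_le {n : ℕ} {r : Finset (Fin n) → Fin n → ℝ} {s : ℕ} {B : ℝ}
    (hs : s ≤ n) (hB : ∀ T : Finset (Fin n), T.card = s → ∑ j, r T j ≤ B) :
    avgOutside r s + avgInside r s ≤ B := by
  have hpos : (0 : ℝ) < n.choose s := by exact_mod_cast Nat.choose_pos hs
  rw [avgOutside, avgInside, ← add_div, div_le_iff₀ hpos, ← Finset.sum_add_distrib]
  calc ∑ T ∈ Finset.powersetCard s (Finset.univ : Finset (Fin n)),
        (∑ j ∈ Tᶜ, r T j + ∑ j ∈ T, r T j)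
      ≤ ∑ T ∈ Finset.powersetCard s (Finset.univ : Finset (Fin n)), B := by
        refine Finset.sum_le_sum fun T hT => ?_
        rw [Finset.sum_compl_add_sum]
        exact hB T (Finset.mem_powersetCard_univ.1 hT)
    _ = B * n.choose s := by simp [mul_comm]

/-- The uniform weights on the sets of size `s` and on those of size `s + 1` stand in the ratio
`n - s` to `s + 1`, so the two-point bounds between neighbouring sets bound the sum of the two
averages. -/
lemma le_avgOutside_add_avgInside {n s : ℕ} (hs : s < n) {r D : Finset (Fin n) → Fin n → ℝ}
    {κ : ℝ} (hκ : 0 ≤ κ)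
    (hD : ∀ T : Finset (Fin n), T.card = s → ∑ j ∈ Tᶜ, D T j ≤ (n : ℝ) - s)
    (hr : ∀ T : Finset (Fin n), T.card = s → ∀ j ∉ T, ∀ w₀ w₁ : ℝ, 0 < w₀ → 0 < w₁ →
      κ * (w₀ * w₁ / (w₀ + w₁)) * (2 - D T j) ≤ w₀ * r T j + w₁ * r (insert j T) j) :
    κ * (((n : ℝ) - s) * (s + 1) / (n + 1)) ≤ avgOutside r s + avgInside r (s + 1) := by
  have hns : (0 : ℝ) < (n : ℝ) - s := sub_pos.2 (by exact_mod_cast hs)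
  have hpos : (0 : ℝ) < n.choose s := by exact_mod_cast Nat.choose_pos hs.le
  have hpos' : (0 : ℝ) < n.choose (s + 1) := by exact_mod_cast Nat.choose_pos hs
  have hchoose : (n.choose (s + 1) : ℝ) * (s + 1) = n.choose s * ((n : ℝ) - s) := by
    have := Nat.choose_succ_right_eq n s
    rw [← Nat.cast_sub hs.le]
    exact_mod_cast this
  set h := ((n : ℝ) - s) * (s + 1) / (n + 1) with hh
  have hh0 : 0 ≤ h := by positivity
  have key : ∀ T ∈ Finset.powersetCard s (Finset.univ : Finset (Fin n)),
      κ * h * ((n : ℝ) - s) ≤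
        ((n : ℝ) - s) * ∑ j ∈ Tᶜ, r T j + (s + 1) * ∑ j ∈ Tᶜ, r (insert j T) j := by
    intro T hT
    have hT := Finset.mem_powersetCard_univ.1 hT
    rw [Finset.mul_sum, Finset.mul_sum, ← Finset.sum_add_distrib]
    calc κ * h * ((n : ℝ) - s) ≤ κ * h * ∑ j ∈ Tᶜ, (2 - D T j) := by
          refine mul_le_mul_of_nonneg_left ?_ (by positivity)
          rw [Finset.sum_sub_distrib, Finset.sum_const, Finset.card_compl, hT, Fintype.card_fin,
            nsmul_eq_mul, Nat.cast_sub hs.le]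
          linarith [hD T hT]
      _ = ∑ j ∈ Tᶜ, κ * h * (2 - D T j) := by rw [Finset.mul_sum]
      _ ≤ _ := by
          refine Finset.sum_le_sum fun j hj => ?_
          have := hr T hT j (Finset.mem_compl.1 hj) ((n : ℝ) - s) (s + 1) hns (by positivity)
          rwa [show (n : ℝ) - s + (s + 1) = n + 1 by ring] at this
  have hsum := Finset.sum_le_sum key
  rw [Finset.sum_const, Finset.card_powersetCard, Finset.card_univ, Fintype.card_fin, nsmul_eq_mul,
    Finset.sum_add_distrib, ← Finset.mul_sum, ← Finset.mul_sum, ← sum_powersetCard_succ] at hsum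
  have hin : avgInside r (s + 1) =
      (s + 1) * (∑ S ∈ Finset.powersetCard (s + 1) (Finset.univ : Finset (Fin n)),
        ∑ j ∈ S, r S j) / (n.choose s * ((n : ℝ) - s)) := by
    rw [avgInside, ← hchoose]
    field_simp
  have hout : avgOutside r s =
      ((n : ℝ) - s) * (∑ T ∈ Finset.powersetCard s (Finset.univ : Finset (Fin n)),
        ∑ j ∈ Tᶜ, r T j) / (n.choose s * ((n : ℝ) - s)) := by
    rw [avgOutside]
    field_simp
  rw [hin, hout, ← add_div, le_div_iff₀ (by positivity)]
  calc _ = (n.choose s : ℝ) * (κ * h * ((n : ℝ) - s)) := by ring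
    _ ≤ _ := hsum

/-- If the risk is at most `B` at every set of size at most `k`, then summing the bounds for the
pairs of neighbouring sizes `s, s + 1` in the window `[k - L, k]` uses each size at most once in
each of its two roles. -/
lemma window_lower_bound {n k L : ℕ} (hL : L ≤ k) (hkn : 2 * k < n)
    {r D : Finset (Fin n) → Fin n → ℝ} {κ B : ℝ} (hκ : 0 ≤ κ) (hr0 : ∀ T j, 0 ≤ r T j)
    (hB : ∀ T : Finset (Fin n), T.card ≤ k → ∑ j, r T j ≤ B)
    (hD : ∀ T : Finset (Fin n), ∑ j ∈ Tᶜ, D T j ≤ (n : ℝ) - k + 1)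
    (hr : ∀ T : Finset (Fin n), T.card < k → ∀ j ∉ T, ∀ w₀ w₁ : ℝ, 0 < w₀ → 0 < w₁ →
      κ * (w₀ * w₁ / (w₀ + w₁)) * (2 - D T j) ≤ w₀ * r T j + w₁ * r (insert j T) j) :
    L * (κ * (((k : ℝ) - L + 1) / 2)) ≤ (L + 1) * B := by
  obtain ⟨t, rfl⟩ := Nat.exists_eq_add_of_le' hL
  have hkn' : 2 * ((t : ℝ) + L) + 1 ≤ n := by exact_mod_cast hkn
  have hout : ∀ s, 0 ≤ avgOutside r s := fun s =>
    div_nonneg (Finset.sum_nonneg fun T _ => Finset.sum_nonneg fun j _ => hr0 T j) (by positivity)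
  have hin : ∀ s, 0 ≤ avgInside r s := fun s =>
    div_nonneg (Finset.sum_nonneg fun T _ => Finset.sum_nonneg fun j _ => hr0 T j) (by positivity)
  push_cast at hD ⊢
  calc (L : ℝ) * (κ * (((t : ℝ) + L - L + 1) / 2))
      = ∑ _i ∈ Finset.range L, κ * (((t : ℝ) + 1) / 2) := by
        rw [Finset.sum_const, Finset.card_range, nsmul_eq_mul]; ring
    _ ≤ ∑ i ∈ Finset.range L, (avgOutside r (t + i) + avgInside r (t + (i + 1))) := by
        refine Finset.sum_le_sum fun i hi => ?_
        have hi := Finset.mem_range.1 hi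
        have hi' : (i : ℝ) + 1 ≤ L := by exact_mod_cast hi
        refine le_trans ?_ (le_avgOutside_add_avgInside (s := t + i) (by omega) hκ
          (fun T _ => (hD T).trans (by push_cast; linarith)) fun T hT => hr T (by omega))
        refine mul_le_mul_of_nonneg_left ?_ hκ
        push_cast
        rw [div_le_div_iff₀ (by norm_num) (by positivity)]
        have ht : (0 : ℝ) ≤ t := Nat.cast_nonneg t
        have hi0 : (0 : ℝ) ≤ i := Nat.cast_nonneg i
        have h1 : (n : ℝ) + 1 ≤ ((n : ℝ) - (t + i)) * 2 := by linarith
        have h2 : (t : ℝ) + 1 ≤ t + i + 1 := by linarith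
        calc ((t : ℝ) + 1) * (n + 1) ≤ (t + i + 1) * (((n : ℝ) - (t + i)) * 2) := by gcongr
          _ = _ := by ring
    _ ≤ ∑ i ∈ Finset.range (L + 1), (avgOutside r (t + i) + avgInside r (t + i)) := by
        rw [Finset.sum_add_distrib, Finset.sum_add_distrib, Finset.sum_range_succ,
          Finset.sum_range_succ' (fun i => avgInside r (t + i))]
        linarith [hout (t + L), hin (t + 0)]
    _ ≤ ∑ _i ∈ Finset.range (L + 1), B := by
        refine Finset.sum_le_sum fun i hi => ?_
        have hi := Finset.mem_range.1 hi
        exact avgOutside_add_avgInside_le (by omega) fun T hT => hB T (by omega)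
    _ = ((L : ℝ) + 1) * B := by
        rw [Finset.sum_const, Finset.card_range, nsmul_eq_mul]; push_cast; ring

/-! ### The minimax bound -/

/-- The signal equal to `δ` on `T` and to `0` elsewhere. -/
noncomputable def flatSignal {n : ℕ} (δ : ℝ) (T : Finset (Fin n)) : EuclideanSpace ℝ (Fin n) :=
  WithLp.toLp 2 fun j => if j ∈ T then δ else 0

lemma flatSignal_mem_sparseSignals {n k : ℕ} (δ : ℝ) {T : Finset (Fin n)} (hT : T.card ≤ k) :
    flatSignal δ T ∈ sparseSignals n k := by
  have hsub : {j : Fin n | flatSignal δ T j ≠ 0} ⊆ (T : Set (Fin n)) := by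
    intro j hj
    by_contra h
    have h' : j ∉ T := h
    simp [flatSignal, h'] at hj
  calc {j : Fin n | flatSignal δ T j ≠ 0}.ncard ≤ (T : Set (Fin n)).ncard :=
        Set.ncard_le_ncard hsub T.finite_toSet
    _ ≤ k := by rwa [Set.ncard_coe_finset]

lemma flatSignal_insert {n : ℕ} (δ : ℝ) {T : Finset (Fin n)} {j : Fin n} (hj : j ∉ T) :
    flatSignal δ (insert j T) = flatSignal δ T + EuclideanSpace.single j δ := by
  ext l
  by_cases hl : l = j
  · subst hl; simp [flatSignal, hj]
  · simp [flatSignal, hl]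

/-- The minimax lower bound for the window `[k - L, k]` of support sizes. -/
theorem le_minimaxMSE {n k m L : ℕ} {σ : ℝ≥0} (hL : L ≤ k) (hkn : 2 * k < n) (hm : 0 < m)
    (hσ : 0 < σ) :
    ENNReal.ofReal (L * ((k : ℝ) - L + 1) / ((L + 1) * (2 * Real.exp 1)) / m * (σ : ℝ) ^ 2) ≤
      minimaxMSE.{u} n k m σ := by
  refine le_iInf fun A => ?_
  set R := ⨆ x ∈ sparseSignals n k, A.mse σ x with hR
  by_cases hRtop : R = ⊤
  · rw [hRtop]; exact le_top
  rw [ENNReal.ofReal_le_iff_le_toReal hRtop]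
  have hkn' : 2 * (k : ℝ) + 1 ≤ n := by exact_mod_cast hkn
  have hk0 : (0 : ℝ) ≤ k := Nat.cast_nonneg k
  have hLk : (L : ℝ) ≤ k := by exact_mod_cast hL
  have hn0 : (0 : ℝ) < n := by linarith
  have hnne : (n : ℝ≥0∞) ≠ 0 := by exact_mod_cast hn0.ne'
  have hm0 : (0 : ℝ) < m := by exact_mod_cast hm
  have hσ0 : (0 : ℝ) < σ := hσ
  -- The height at which each bound on the total divergence is `n - k + 1`.
  set δ := Real.sqrt (2 * ((n : ℝ) - k + 1) * (σ : ℝ) ^ 2 / m) with hδ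
  have hδ2 : δ ^ 2 = 2 * ((n : ℝ) - k + 1) * (σ : ℝ) ^ 2 / m :=
    Real.sq_sqrt (div_nonneg (mul_nonneg (by linarith) (by positivity)) hm0.le)
  have hsum : ∀ T : Finset (Fin n), T.card ≤ k →
      ∑ j, A.coordRisk σ (flatSignal δ T) j ≤ n * R := by
    intro T hT
    have h1 : A.mse σ (flatSignal δ T) ≤ R :=
      le_iSup₂ (f := fun x _ => A.mse σ x) _ (flatSignal_mem_sparseSignals δ hT)
    calc ∑ j, A.coordRisk σ (flatSignal δ T) j
        = n * A.mse σ (flatSignal δ T) := by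
          rw [A.mse_eq_sum_coordRisk, ← mul_assoc,
            ENNReal.mul_inv_cancel hnne (ENNReal.natCast_ne_top n), one_mul]
      _ ≤ n * R := by gcongr
  have hnR : (n : ℝ≥0∞) * R ≠ ⊤ := ENNReal.mul_ne_top (ENNReal.natCast_ne_top n) hRtop
  have hfin : ∀ T : Finset (Fin n), T.card ≤ k → ∀ j,
      A.coordRisk σ (flatSignal δ T) j ≠ ⊤ := fun T hT j =>
    ne_top_of_le_ne_top hnR ((Finset.single_le_sum (fun _ _ => zero_le)
      (Finset.mem_univ j)).trans (hsum T hT))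
  have hwin := window_lower_bound hL hkn
    (r := fun T j => (A.coordRisk σ (flatSignal δ T) j).toReal)
    (D := fun T j => δ ^ 2 / (2 * (σ : ℝ) ^ 2) * A.energy σ (flatSignal δ T) j)
    (κ := δ ^ 2 * Real.exp (-1)) (B := n * R.toReal) (by positivity)
    (fun _ _ => ENNReal.toReal_nonneg)
    (fun T hT => by
      rw [← ENNReal.toReal_sum fun j _ => hfin T hT j]
      simpa using ENNReal.toReal_mono hnR (hsum T hT))
    (fun T => by
      rw [← Finset.mul_sum]
      calc δ ^ 2 / (2 * (σ : ℝ) ^ 2) * ∑ j ∈ Tᶜ, A.energy σ (flatSignal δ T) j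
          ≤ δ ^ 2 / (2 * (σ : ℝ) ^ 2) * m := by
            gcongr
            exact A.sum_energy_le σ _ _
        _ = (n : ℝ) - k + 1 := by rw [hδ2]; field_simp)
    (fun T hT j hj w₀ w₁ h₀ h₁ => by
      have hi : (insert j T).card ≤ k := by rw [Finset.card_insert_of_notMem hj]; omega
      have hf0 := hfin T hT.le j
      have hf1 := hfin _ hi j
      have h := A.two_point_coordRisk hσ.ne' (flatSignal δ T) j δ h₀ h₁
      rw [← flatSignal_insert δ hj] at h
      have h0' := ENNReal.mul_ne_top (ENNReal.ofReal_ne_top (r := w₀)) hf0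
      have h1' := ENNReal.mul_ne_top (ENNReal.ofReal_ne_top (r := w₁)) hf1
      rw [ENNReal.ofReal_le_iff_le_toReal (ENNReal.add_ne_top.2 ⟨h0', h1'⟩),
        ENNReal.toReal_add h0' h1', ENNReal.toReal_mul, ENNReal.toReal_mul,
        ENNReal.toReal_ofReal h₀.le, ENNReal.toReal_ofReal h₁.le] at h
      refine (le_of_eq ?_).trans h
      ring)
  have hL0 : (0 : ℝ) ≤ L := Nat.cast_nonneg L
  have he : Real.exp (-1) = (Real.exp 1)⁻¹ := Real.exp_neg 1
  have he0 : 0 < Real.exp 1 := Real.exp_pos 1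
  rw [div_div, div_mul_eq_mul_div, div_le_iff₀ (by positivity)]
  rw [hδ2, he] at hwin
  have hX : 0 ≤ (L : ℝ) * ((k : ℝ) - L + 1) * (σ : ℝ) ^ 2 :=
    mul_nonneg (mul_nonneg hL0 (by linarith)) (by positivity)
  -- `2 (n - k + 1) ≥ n` absorbs the factor `n`.
  have h2 : n * ((L : ℝ) * ((k : ℝ) - L + 1) * (σ : ℝ) ^ 2) ≤
      n * (R.toReal * ((L + 1) * (2 * Real.exp 1) * m)) := by
    calc n * ((L : ℝ) * ((k : ℝ) - L + 1) * (σ : ℝ) ^ 2)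
        ≤ (2 * ((n : ℝ) - k + 1)) * ((L : ℝ) * ((k : ℝ) - L + 1) * (σ : ℝ) ^ 2) := by
          gcongr
          linarith
      _ = (L * (2 * ((n : ℝ) - k + 1) * (σ : ℝ) ^ 2 / m * (Real.exp 1)⁻¹ *
            (((k : ℝ) - L + 1) / 2))) * (2 * Real.exp 1 * m) := by field_simp
      _ ≤ ((L + 1) * (n * R.toReal)) * (2 * Real.exp 1 * m) := by gcongr
      _ = _ := by ring
  exact le_of_mul_le_mul_left h2 hn0

theorem theorem2 :
    ∃ C : ℕ → ℝ,
      (∀ (n k m : ℕ) (σ : ℝ≥0), 2 ≤ n → (k : ℝ) < (n : ℝ) / 2 → 0 < m → 0 < σ →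
        ENNReal.ofReal (C k * ((k : ℝ) / (m : ℝ)) * (σ : ℝ) ^ 2) ≤ minimaxMSE.{u} n k m σ) ∧
      (∀ k : ℕ, 1 ≤ k → 1 / 33 ≤ C k) ∧
      (∀ k : ℕ, 10 ≤ k → 1 / 15 ≤ C k) ∧
      (∃ K : ℕ, ∀ k : ℕ, K ≤ k → C k = 1 / 7) := by
  refine ⟨fun k => if k < 100 then 1 / 15 else 1 / 7, ?_, ?_, ?_, 100, ?_⟩
  · intro n k m σ _ hk hm hσ
    have hkn : 2 * k < n := by
      have : 2 * (k : ℝ) < n := by linarith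
      exact_mod_cast this
    have he := Real.exp_one_lt_d9
    have he0 := Real.exp_pos 1
    rcases Nat.eq_zero_or_pos k with rfl | hk0
    · simp
    have hk0' : (1 : ℝ) ≤ k := by exact_mod_cast hk0
    -- A window of two sizes has constant `1 / (4 e)`; one of eight sizes suffices for large `k`.
    have key : ∃ L : ℕ, L ≤ k ∧ (if k < 100 then 1 / 15 else 1 / 7 : ℝ) * k ≤
        L * ((k : ℝ) - L + 1) / ((L + 1) * (2 * Real.exp 1)) := by
      by_cases h : k < 100
      · refine ⟨1, hk0, ?_⟩
        rw [if_pos h, le_div_iff₀ (by positivity)]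
        push_cast
        nlinarith
      · have hk100 : (100 : ℝ) ≤ k := by exact_mod_cast not_lt.1 h
        refine ⟨7, by omega, ?_⟩
        rw [if_neg h, le_div_iff₀ (by positivity)]
        push_cast
        nlinarith
    obtain ⟨L, hL, hC⟩ := key
    refine le_trans (ENNReal.ofReal_le_ofReal ?_) (le_minimaxMSE hL hkn hm hσ)
    simp only [← mul_div_assoc]
    gcongr
  · intro k _
    dsimp only
    split_ifs <;> norm_num
  · intro k _
    dsimp only
    split_ifs <;> norm_num
  · intro k hk
    exact if_neg (not_lt.2 hk)
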